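/- Let $\mathcal H$ be a finite-dimensional complex Hilbert space and write $\mathcal P_1(\mathcal K)$ for the set of pure states (rank-one orthogonal projectors) of a subspace $\mathcal K\subseteq\mathcal H$, viewed as operators on $\mathcal H$. Let $M$ be a set of mutually commuting positive semidefinite trace-one operators on $\mathcal H$ (the macro observables), and let $D_M(\rho,\sigma)=\sup_{B\in M}|\mathrm{Tr}[B(\rho-\sigma)]|$ (with $D_M=0$ if $M=\emptyset$). Suppose that $\mathcal H=\bigoplus_{r=1}^m\mathcal H_r$ is a decomposition into $m$ nonzero, mutually orthogonal subspaces such that $D_M(\rho,\sigma)=0$ for all $r$ and all $\rho,\sigma\in\mathcal P_1(\mathcal H_r)$, and $D_M(\rho,\sigma)>0$ whenever $r\neq s$, $\rho\in\mathcal P_1(\mathcal H_r)$, $\sigma\in\mathcal P_1(\mathcal H_s)$. Call an operator accessible if it has the form $A=\sum_{r=1}^m\alpha_r\Pi_r$ with $\alpha_r\in\mathbb R$, where $\Pi_r$ is the orthogonal projector onto $\mathcal H_r$. Let $\mathcal H_R\subseteq\mathcal H$ be a nonzero subspace of dimension $d_R$ with orthogonal projector $\Pi_R$, put $\langle A\rangle_{\mathrm{mc}}=\mathrm{Tr}[\tfrac{\Pi_R}{d_R}A]$,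 and let $\psi\in\mathcal P_1(\mathcal H_R)$ be a random pure state distributed according to the Haar (unitarily invariant probability) measure on $\mathcal P_1(\mathcal H_R)$. Then for all $\varepsilon>0$ and $K>0$, \[ \Pr\Big\{\text{there is an accessible } A \text{ with } \|A\|_\infty\le K \text{ and } |\mathrm{Tr}[A\psi]-\langle A\rangle_{\mathrm{mc}}|\ge\varepsilon\Big\}\;\le\; 2m\,\exp\!\Big(-\frac{C\,d_R\,\varepsilon^2}{m^2K^2}\Big),\qquad C=\frac{1}{36\pi^3}, \] where $\|\cdot\|_\infty$ is the operator norm. -/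

import Mathlib

open MeasureTheory InnerProductSpace

noncomputable section

namespace MacroTypicality

section PureStates

variable (E : Type*) [NormedAddCommGroup E] [InnerProductSpace ℂ E] [FiniteDimensional ℂ E]

/-- The set `𝒫₁(E)` of pure states of the Hilbert space `E`: the rank-one orthogonal projectors. -/
def PureState : Type _ :=
  {p : E →L[ℂ] E // IsStarProjection p ∧ Module.finrank ℂ (LinearMap.range (p : E →ₗ[ℂ] E)) = 1}

variable {E}

/-- Pure states carry the Borel σ-algebra of the topology inherited from the operators. -/
instance : TopologicalSpace (PureState E) := instTopologicalSpaceSubtype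

instance : MeasurableSpace (PureState E) := Subtype.instMeasurableSpace

instance : BorelSpace (PureState E) := Subtype.borelSpace _

/-- The projector `|φ⟩⟨φ|` onto the line spanned by a normalized vector `φ`. -/
def PureState.ofVector (φ : Metric.sphere (0 : E) 1) : PureState E :=
  ⟨rankOne ℂ (φ : E) (φ : E), isStarProjection_rankOne_self (by simp), by
    have h0 : (φ : E) ≠ 0 := by
      intro h
      have h1 : ‖(φ : E)‖ = 1 := by simp
      rw [h, norm_zero] at h1
      exact zero_ne_one h1
    have : LinearMap.range ((rankOne ℂ (φ : E) (φ : E) : E →L[ℂ] E) : E →ₗ[ℂ] E)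
        = Submodule.span ℂ {(φ : E)} := by
      ext x
      simp only [LinearMap.mem_range, ContinuousLinearMap.coe_coe, rankOne_apply,
        Submodule.mem_span_singleton]
      constructor
      · rintro ⟨y, rfl⟩
        exact ⟨_, rfl⟩
      · rintro ⟨a, rfl⟩
        refine ⟨a • (φ : E), ?_⟩
        rw [inner_smul_right, inner_self_eq_norm_sq_to_K]
        simp
    rw [this, finrank_span_singleton h0]⟩

theorem PureState.continuous_ofVector : Continuous (PureState.ofVector (E := E)) := by
  refine Continuous.subtype_mk ?_ _
  have : (fun φ : Metric.sphere (0 : E) 1 => rankOne ℂ (φ : E) (φ : E))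
      = fun φ : Metric.sphere (0 : E) 1 => (innerSL ℂ (φ : E)).smulRight (φ : E) := by
    ext φ; rfl
  rw [this]
  fun_prop

variable (E) [MeasurableSpace E] [BorelSpace E]

/-- Lebesgue measure on `E`, seen as a real Euclidean space of dimension `2 dim_ℂ E`. -/
def euclideanVolume : Measure E :=
  letI : InnerProductSpace ℝ E := InnerProductSpace.complexToReal
  volume

instance : (euclideanVolume E).IsAddHaarMeasure := by
  let : InnerProductSpace ℝ E := InnerProductSpace.complexToReal
  exact inferInstanceAs (volume : Measure E).IsAddHaarMeasure

/-- The uniform (rotation invariant, normalized) probability measure on the unit sphere of `E`. -/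
def uniformSphere : Measure (Metric.sphere (0 : E) 1) :=
  ((euclideanVolume E).toSphere Set.univ)⁻¹ • (euclideanVolume E).toSphere

/-- The law of a random pure state of `E`: the Haar measure on `𝒫₁(E)`, i.e. the unitarily
invariant probability measure, realized as the law of `|φ⟩⟨φ|` for `φ` uniform on the sphere. -/
def haarPure : Measure (PureState E) :=
  (uniformSphere E).map PureState.ofVector

instance [Nontrivial E] : IsProbabilityMeasure (uniformSphere E) := by
  constructor
  rw [uniformSphere, Measure.smul_apply, smul_eq_mul]
  refine ENNReal.inv_mul_cancel ?_ (measure_ne_top _ _)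
  rw [Ne, Measure.measure_univ_eq_zero]
  exact Measure.toSphere_ne_zero _

instance [Nontrivial E] : IsProbabilityMeasure (haarPure E) :=
  Measure.isProbabilityMeasure_map PureState.continuous_ofVector.measurable.aemeasurable

end PureStates

section Macro

variable {H : Type*} [NormedAddCommGroup H] [InnerProductSpace ℂ H] [FiniteDimensional ℂ H]

/-- The trace of an operator on the finite-dimensional Hilbert space `H`. -/
def opTrace (A : H →L[ℂ] H) : ℂ := LinearMap.trace ℂ H (A : H →ₗ[ℂ] H)

/-- A pure state of a subspace `R ⊆ H`, seen as an operator (density matrix) on `H`. -/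
def PureState.toOp {R : Submodule ℂ H} (ψ : PureState R) : H →L[ℂ] H :=
  R.subtypeL ∘L ψ.1 ∘L R.orthogonalProjectionOnto

/-- The microcanonical state `Π_R / d_R` of the restricted subspace `R`. -/
def microcanonicalState (R : Submodule ℂ H) : H →L[ℂ] H :=
  ((Module.finrank ℂ R : ℂ)⁻¹) • R.starProjection

/-- The microcanonical expectation value `Tr[(Π_R / d_R) A]`. -/
def mcExpectation (R : Submodule ℂ H) (A : H →L[ℂ] H) : ℂ :=
  opTrace (microcanonicalState R * A)

/-- A set of macro observables: positive semidefinite, trace one, mutually commuting. -/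
structure IsMacroObservableSet (M : Set (H →L[ℂ] H)) : Prop where
  positive : ∀ B ∈ M, B.IsPositive
  trace_one : ∀ B ∈ M, opTrace B = 1
  commute : ∀ B ∈ M, ∀ B' ∈ M, Commute B B'

/-- The pseudo distance between two states induced by the macro observables: the largest difference
of the two expectation values. -/
def macroDist (M : Set (H →L[ℂ] H)) (ρ σ : H →L[ℂ] H) : ℝ :=
  ⨆ B : M, ‖opTrace ((B : H →L[ℂ] H) * (ρ - σ))‖

/-- `V 0, …, V (m - 1)` is the partition of `H` into `m` mutually orthogonal subspaces of
macroscopically distinguishable states with respect to the macro observables `M`: pure states from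
one subspace cannot be distinguished by `M`, pure states from different subspaces can. -/
structure IsMacroPartition (M : Set (H →L[ℂ] H)) {m : ℕ} (V : Fin m → Submodule ℂ H) : Prop where
  ne_bot : ∀ r, V r ≠ ⊥
  orthogonal : ∀ r s, r ≠ s → V r ⟂ V s
  iSup_eq_top : ⨆ r, V r = ⊤
  indistinguishable : ∀ r, ∀ ρ σ : PureState (V r), macroDist M ρ.toOp σ.toOp = 0
  distinguishable : ∀ r s, r ≠ s → ∀ (ρ : PureState (V r)) (σ : PureState (V s)),
    0 < macroDist M ρ.toOp σ.toOp

/-- The accessible macroscopic observables `A = ∑ r, α_r Π_r` with real `α_r`, where `Π_r` is the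
orthogonal projector onto `V r`. -/
def accessibleObservables {m : ℕ} (V : Fin m → Submodule ℂ H) : Set (H →L[ℂ] H) :=
  {A | ∃ α : Fin m → ℝ, A = ∑ r, (α r : ℂ) • (V r).starProjection}

end Macro

end MacroTypicality

end

/-! An accessible `A` acts on each nonzero `V r` as the scalar `α r`, so `‖A‖ ≤ K` forces `|α r| ≤
K`. The deviation of `A` is linear in the `α r`; if it reaches `ε`, some projector onto a `V r`
deviates by at least `ε / (m * K)` (`exists_projector_deviation`). A union bound over these `m`
events covers all `A` at once.

For one projector, compress it to an operator `0 ≤ T ≤ 1` on `R`: the deviation becomes `⟪φ, T φ⟫ -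
tr T / d` for a uniform unit vector `φ` (`d = dim R`). Its tail (`uniformSphere_upper_tail`) comes
from a Gaussian Chernoff argument rather than Lévy's lemma. The event that the deviation is at least
`t` is the trace on the sphere of a cone where the quadratic form `Q x = ⟪x, T x⟫ - (tr T / d + t)
‖x‖²` is nonnegative, so there `exp (-‖x‖²) ≤ exp (-‖x‖² + s * Q x)` for `s ≥ 0`. Integrating in
polar coordinates on the left and in an eigenbasis of `T` on the right bounds the probability by `∏
(1 - s (λ i - tr T / d - t))⁻¹`. The choice `s = t / 16` gives `exp (-d t² / 32)`, and `32 ≤ 36 π³`.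
-/

namespace MacroTypicality

open Metric Set ENNReal

/-! ### Polar coordinates and cones over subsets of the sphere -/

section Polar

variable {E : Type*} [NormedAddCommGroup E] [NormedSpace ℝ E]

/-- The cone over a subset of the unit sphere, without its apex. -/
def sphereCone (S : Set (sphere (0 : E) 1)) : Set E :=
  (↑) '' ((fun x : ({0}ᶜ : Set E) => (homeomorphUnitSphereProd E x).1) ⁻¹' S)

theorem sphereCone_univ : sphereCone (univ : Set (sphere (0 : E) 1)) = {0}ᶜ := by
  simp only [sphereCone, preimage_univ, image_univ, Subtype.range_coe]

theorem exists_eq_smul_of_mem_sphereCone {S : Set (sphere (0 : E) 1)} {x : E}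
    (hx : x ∈ sphereCone S) : ∃ φ ∈ S, ∃ r : ℝ, 0 < r ∧ x = r • (φ : E) := by
  obtain ⟨y, hy, rfl⟩ := hx
  have hy0 : (y : E) ≠ 0 := y.2
  refine ⟨_, hy, ‖(y : E)‖, norm_pos_iff.2 hy0, ?_⟩
  simp [smul_smul, hy0]

variable [MeasurableSpace E] [BorelSpace E]

theorem measurableSet_sphereCone {S : Set (sphere (0 : E) 1)} (hS : MeasurableSet S) :
    MeasurableSet (sphereCone S) := by
  refine (MeasurableEmbedding.subtype_coe (measurableSet_singleton 0).compl).measurableSet_image.2 ?_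
  exact (continuous_fst.comp (homeomorphUnitSphereProd E).continuous).measurable hS

variable [FiniteDimensional ℝ E]

/-- Integration of a radial function over a cone in polar coordinates. -/
theorem lintegral_radial_sphereCone (μ : Measure E) [μ.IsAddHaarMeasure]
    {g : ℝ → ℝ≥0∞} (hg : Measurable g) {S : Set (sphere (0 : E) 1)} (hS : MeasurableSet S) :
    ∫⁻ x in sphereCone S, g ‖x‖ ∂μ = μ.toSphere S *
      ∫⁻ r : Ioi (0 : ℝ), g r ∂(Measure.volumeIoiPow (Module.finrank ℝ E - 1)) := by
  have hmp := μ.measurePreserving_homeomorphUnitSphereProd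
  have hemb := MeasurableEmbedding.subtype_coe (measurableSet_singleton (0 : E)).compl
  have h1 : ∫⁻ x in sphereCone S, g ‖x‖ ∂μ =
      ∫⁻ x : ({0}ᶜ : Set E), S.indicator 1 (homeomorphUnitSphereProd E x).1 *
        g (homeomorphUnitSphereProd E x).2 ∂(μ.comap (↑)) := by
    have h2 : ∀ x : ({0}ᶜ : Set E), S.indicator 1 (homeomorphUnitSphereProd E x).1 *
        g (homeomorphUnitSphereProd E x).2 =
        (sphereCone S).indicator (fun x => g ‖x‖) (x : E) := by
      intro x
      have : (x : E) ∈ sphereCone S ↔ (homeomorphUnitSphereProd E x).1 ∈ S := by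
        simp only [sphereCone]
        rw [Subtype.val_injective.mem_set_image]
        rfl
      by_cases h : (homeomorphUnitSphereProd E x).1 ∈ S
      · rw [indicator_of_mem h, indicator_of_mem (this.2 h)]; simp
      · rw [indicator_of_notMem h, indicator_of_notMem (mt this.1 h)]; simp
    simp_rw [h2]
    rw [← hemb.lintegral_map, hemb.map_comap, Subtype.range_coe,
      lintegral_indicator (measurableSet_sphereCone hS), Measure.restrict_restrict
        (measurableSet_sphereCone hS)]
    congr 2
    refine (inter_eq_left.2 ?_).symm
    rintro _ ⟨y, -, rfl⟩
    exact y.2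
  rw [h1, hmp.lintegral_comp (f := fun p => S.indicator 1 p.1 * g p.2)
      (((measurable_one.indicator hS).comp measurable_fst).mul
        (hg.comp (measurable_subtype_coe.comp measurable_snd)))]
  rw [lintegral_prod_mul (g := fun r : Ioi (0 : ℝ) => g r)
    (measurable_one.indicator hS).aemeasurable (hg.comp measurable_subtype_coe).aemeasurable,
    lintegral_indicator_one hS]

/-- If `f` dominates `g ‖x‖` on the cone over `S`, then the normalized measure of `S` is at most the
ratio of the integrals of `f` and of `g ‖x‖`. -/
theorem toSphere_mul_lintegral_le [Nontrivial E] (μ : Measure E) [μ.IsAddHaarMeasure]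
    {g : ℝ → ℝ≥0∞} (hg : Measurable g) {S : Set (sphere (0 : E) 1)} (hS : MeasurableSet S)
    {f : E → ℝ≥0∞} (hf : ∀ x ∈ sphereCone S, g ‖x‖ ≤ f x) :
    ((μ.toSphere univ)⁻¹ • μ.toSphere) S * ∫⁻ x, g ‖x‖ ∂μ ≤ ∫⁻ x, f x ∂μ := by
  have h0 : μ.toSphere univ ≠ 0 := by
    rw [Ne, Measure.measure_univ_eq_zero]
    exact Measure.toSphere_ne_zero _
  have h1 := lintegral_radial_sphereCone μ hg (MeasurableSet.univ (α := sphere (0 : E) 1))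
  rw [sphereCone_univ, Measure.restrict_eq_self_of_ae_mem (s := {0}ᶜ)
    (compl_mem_ae_iff.2 (measure_singleton 0))] at h1
  rw [h1, Measure.smul_apply, smul_eq_mul]
  calc _ = ((μ.toSphere univ)⁻¹ * μ.toSphere univ) * (μ.toSphere S *
      ∫⁻ r : Ioi (0 : ℝ), g r ∂(Measure.volumeIoiPow (Module.finrank ℝ E - 1))) := by ring
    _ = ∫⁻ x in sphereCone S, g ‖x‖ ∂μ := by
      rw [ENNReal.inv_mul_cancel h0 (measure_ne_top _ _), one_mul,
        lintegral_radial_sphereCone μ hg hS]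
    _ ≤ ∫⁻ x in sphereCone S, f x ∂μ := setLIntegral_mono_ae' (measurableSet_sphereCone hS)
        (ae_of_all _ hf)
    _ ≤ _ := setLIntegral_le_lintegral _ _

end Polar

/-! ### Gaussian integrals of diagonal quadratic forms -/

section Gaussian

theorem lintegral_gaussian_pi {n : ℕ} {a : Fin n → ℝ} (ha : ∀ i, 0 < a i) :
    ∫⁻ z : Fin n → ℂ, ENNReal.ofReal (Real.exp (-∑ i, a i * ‖z i‖ ^ 2)) =
      ENNReal.ofReal (Real.pi ^ n) * ENNReal.ofReal (∏ i, (a i)⁻¹) := by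
  have h1 : ∫ z : Fin n → ℂ, Real.exp (-∑ i, a i * ‖z i‖ ^ 2) = ∏ i, (Real.pi / a i) := by
    have : ∀ z : Fin n → ℂ, Real.exp (-∑ i, a i * ‖z i‖ ^ 2) =
        ∏ i, Real.exp (-a i * ‖z i‖ ^ 2) := fun z => by
      rw [← Real.exp_sum, ← Finset.sum_neg_distrib]
      simp
    simp_rw [this]
    rw [integral_fintype_prod_volume_eq_prod (fun i (w : ℂ) => Real.exp (-a i * ‖w‖ ^ 2))]
    refine Finset.prod_congr rfl fun i _ => ?_
    rw [GaussianFourier.integral_rexp_neg_mul_sq_norm (ha i)]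
    simp
  have hpos : 0 < ∏ i, (Real.pi / a i) :=
    Finset.prod_pos fun i _ => div_pos Real.pi_pos (ha i)
  -- A non-integrable function has integral `0` by convention, which the positive value in `h1`
  -- rules out.
  have hint : Integrable fun z : Fin n → ℂ => Real.exp (-∑ i, a i * ‖z i‖ ^ 2) := by
    by_contra h
    rw [integral_undef h] at h1
    exact hpos.ne h1
  rw [← ofReal_integral_eq_lintegral_ofReal hint (ae_of_all _ fun _ => (Real.exp_pos _).le), h1,
    ← ENNReal.ofReal_mul (by positivity)]
  simp [div_eq_mul_inv, Finset.prod_mul_distrib]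

variable {E : Type*} [NormedAddCommGroup E] [InnerProductSpace ℂ E] [FiniteDimensional ℂ E]
  [MeasurableSpace E] [BorelSpace E]

/-- Coordinates carry `μ` to a multiple of Lebesgue measure. The constant `c` does not depend on
`a`, so it cancels from ratios of Gaussian integrals and need not be computed. -/
theorem exists_lintegral_gaussian_basis (μ : Measure E) [μ.IsAddHaarMeasure] {n : ℕ}
    (b : OrthonormalBasis (Fin n) ℂ E) :
    ∃ c : ℝ≥0∞, c ≠ 0 ∧ c ≠ ∞ ∧ ∀ a : Fin n → ℝ, (∀ i, 0 < a i) →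
      ∫⁻ x, ENNReal.ofReal (Real.exp (-∑ i, a i * ‖b.repr x i‖ ^ 2)) ∂μ =
        c * ENNReal.ofReal (∏ i, (a i)⁻¹) := by
  have : FiniteDimensional ℝ E := FiniteDimensional.complexToReal E
  let L : E ≃L[ℝ] (Fin n → ℂ) := ((b.repr.toLinearEquiv.trans
    (WithLp.linearEquiv 2 ℂ (Fin n → ℂ))).restrictScalars ℝ).toContinuousLinearEquiv
  have hL : ∀ x i, L x i = b.repr x i := fun x i => rfl
  have hν : μ.map L = (Measure.addHaarScalarFactor (μ.map L) volume) • volume :=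
    Measure.isAddLeftInvariant_eq_smul _ _
  set k := Measure.addHaarScalarFactor (μ.map L) (volume : Measure (Fin n → ℂ)) with hk
  have hk0 : k ≠ 0 := by
    intro h
    rw [h, zero_smul] at hν
    exact (NeZero.ne (μ.map L)) hν
  refine ⟨k * ENNReal.ofReal (Real.pi ^ n), ?_, ?_, fun a ha => ?_⟩
  · have : 0 < Real.pi ^ n := by positivity
    simp [hk0, this]
  · exact ENNReal.mul_ne_top ENNReal.coe_ne_top ENNReal.ofReal_ne_top
  · have hLm : MeasurableEmbedding L := L.toHomeomorph.measurableEmbedding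
    simp_rw [← hL]
    rw [← hLm.lintegral_map (μ := μ)
      (f := fun z : Fin n → ℂ => ENNReal.ofReal (Real.exp (-∑ i, a i * ‖z i‖ ^ 2)))]
    rw [hν, lintegral_smul_measure, lintegral_gaussian_pi ha, mul_assoc]
    rfl

end Gaussian

/-! ### Chernoff bound and concentration on the sphere -/

section Concentration

variable {E : Type*} [NormedAddCommGroup E] [InnerProductSpace ℂ E] [FiniteDimensional ℂ E]

/-- Rests on `(1 - x) (1 + x + 2 x²) = 1 + x² (1 - 2 x) ≥ 1`. -/
theorem inv_one_sub_le_exp {x : ℝ} (hx : x ≤ 1 / 2) :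
    (1 - x)⁻¹ ≤ Real.exp (x + 2 * x ^ 2) := by
  have h1 : (1 - x)⁻¹ ≤ x + 2 * x ^ 2 + 1 := by
    rw [inv_le_iff_one_le_mul₀ (by linarith)]
    nlinarith [mul_nonneg (sq_nonneg x) (by linarith : 0 ≤ 1 - 2 * x)]
  exact h1.trans (Real.add_one_le_exp _)

/-- The Chernoff bound for weighted sums of exponential variables with weights
`lam i - mean - t`. -/
theorem prod_inv_one_sub_le {n : ℕ} {lam : Fin n → ℝ} (h0 : ∀ i, 0 ≤ lam i) (h1 : ∀ i, lam i ≤ 1)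
    (hn : 0 < n) {t : ℝ} (ht0 : 0 < t) (ht1 : t ≤ 1) :
    (∀ i, 0 < 1 - t / 16 * (lam i - (∑ j, lam j) / n - t)) ∧
      ∏ i, (1 - t / 16 * (lam i - (∑ j, lam j) / n - t))⁻¹ ≤ Real.exp (-(n * t ^ 2 / 32)) := by
  have hn' : (0 : ℝ) < n := by exact_mod_cast hn
  set μ := (∑ j, lam j) / n with hμ
  have hsum : ∑ j, lam j = n * μ := by rw [hμ]; field_simp
  have hμ0 : 0 ≤ μ := div_nonneg (Finset.sum_nonneg fun i _ => h0 i) hn'.le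
  have hμ1 : μ ≤ 1 := by
    rw [hμ, div_le_one hn']
    calc ∑ j, lam j ≤ ∑ _j : Fin n, (1 : ℝ) := Finset.sum_le_sum fun i _ => h1 i
      _ = n := by simp
  have hx : ∀ i, t / 16 * (lam i - μ - t) ≤ 1 / 2 := fun i => by
    have := h1 i
    nlinarith
  have hsq : ∀ i, (lam i - μ - t) ^ 2 ≤ 4 := fun i => by
    have := h1 i
    have := h0 i
    nlinarith [mul_nonneg (by linarith : 0 ≤ lam i - μ - t + 2)
      (by linarith : 0 ≤ 2 - (lam i - μ - t))]
  refine ⟨fun i => by linarith [hx i], ?_⟩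
  -- With `x = t / 16 * (lam i - μ - t)`, the quadratic term is `2 x² ≤ 2 (t / 16)² * 4 = t² / 32`,
  -- while the linear terms sum to `-n t² / 16`. The value `s = t / 16` minimizes the resulting
  -- exponent `n (8 s² - s t)`.
  calc ∏ i, (1 - t / 16 * (lam i - μ - t))⁻¹
      ≤ ∏ i, Real.exp (t / 16 * (lam i - μ - t) + t ^ 2 / 32) := by
        refine Finset.prod_le_prod (fun i _ => inv_nonneg.2 (by linarith [hx i])) fun i _ => ?_
        refine (inv_one_sub_le_exp (hx i)).trans (Real.exp_le_exp.2 ?_)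
        nlinarith [mul_le_mul_of_nonneg_left (hsq i) (sq_nonneg t)]
    _ = Real.exp (-(n * t ^ 2 / 32)) := by
        rw [← Real.exp_sum]
        congr 1
        rw [Finset.sum_add_distrib, ← Finset.mul_sum, Finset.sum_sub_distrib,
          Finset.sum_sub_distrib, hsum]
        simp
        ring

theorem re_inner_apply_self_eq_sum {T : E →ₗ[ℂ] E} (hT : T.IsSymmetric) {n : ℕ}
    (hn : Module.finrank ℂ E = n) (x : E) :
    (inner ℂ x (T x)).re =
      ∑ i, hT.eigenvalues hn i * ‖(hT.eigenvectorBasis hn).repr x i‖ ^ 2 := by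
  rw [← (hT.eigenvectorBasis hn).repr.inner_map_map, PiLp.inner_apply, Complex.re_sum]
  refine Finset.sum_congr rfl fun i _ => ?_
  rw [hT.eigenvectorBasis_apply_self_apply hn, RCLike.inner_apply, mul_assoc, RCLike.mul_conj]
  norm_cast

theorem eigenvalues_eq_re_inner {T : E →ₗ[ℂ] E} (hT : T.IsSymmetric) {n : ℕ}
    (hn : Module.finrank ℂ E = n) (i : Fin n) :
    hT.eigenvalues hn i =
      (inner ℂ (hT.eigenvectorBasis hn i) (T (hT.eigenvectorBasis hn i))).re := by
  rw [hT.apply_eigenvectorBasis, inner_smul_right, inner_self_eq_norm_sq_to_K]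
  simp

variable [MeasurableSpace E] [BorelSpace E]

/-- Upper tail of the expectation value of an operator `0 ≤ T ≤ 1` in a uniformly distributed unit
vector. -/
theorem uniformSphere_upper_tail [Nontrivial E] {T : E →ₗ[ℂ] E} (hT : T.IsSymmetric)
    (h0 : ∀ x, 0 ≤ (inner ℂ x (T x)).re) (h1 : ∀ x, (inner ℂ x (T x)).re ≤ ‖x‖ ^ 2)
    {t : ℝ} (ht : 0 < t) :
    uniformSphere E {φ | t ≤ (inner ℂ (φ : E) (T φ)).re -
        (T.trace ℂ E).re / Module.finrank ℂ E} ≤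
      ENNReal.ofReal (Real.exp (-(Module.finrank ℂ E * t ^ 2 / 32))) := by
  obtain ⟨n, hn⟩ : ∃ n, Module.finrank ℂ E = n := ⟨_, rfl⟩
  have hn0 : 0 < n := hn ▸ Module.finrank_pos
  have htr : (T.trace ℂ E).re = ∑ i, hT.eigenvalues hn i := hT.re_trace_eq_sum_eigenvalues hn
  have hl0 : ∀ i, 0 ≤ hT.eigenvalues hn i := fun i => by
    rw [eigenvalues_eq_re_inner]; exact h0 _
  have hl1 : ∀ i, hT.eigenvalues hn i ≤ 1 := fun i => by
    rw [eigenvalues_eq_re_inner]; exact (h1 _).trans (by simp)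
  rw [hn, htr]
  set S : Set (sphere (0 : E) 1) := {φ | t ≤ (inner ℂ (φ : E) (T φ)).re -
    (∑ i, hT.eigenvalues hn i) / n} with hSdef
  -- The Chernoff bound needs `t ≤ 1`; for larger `t` the event is empty because `⟪φ, T φ⟫ ≤ 1` and
  -- the mean is nonnegative.
  rcases lt_or_ge 1 t with ht1 | ht1
  · have : S = ∅ := by
      ext φ
      simp only [hSdef, mem_ofPred_eq, mem_empty_iff_false, iff_false, not_le]
      have h2 := h1 φ
      have h3 : 0 ≤ (∑ i, hT.eigenvalues hn i) / n := div_nonneg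
        (Finset.sum_nonneg fun i _ => hl0 i) n.cast_nonneg
      rw [norm_eq_of_mem_sphere] at h2
      linarith
    rw [this, measure_empty]
    exact zero_le
  have hS : MeasurableSet S := by
    have : Continuous T := T.continuous_of_finiteDimensional
    refine (isClosed_le continuous_const ?_).measurableSet
    refine (Complex.continuous_re.comp (continuous_subtype_val.inner
      (this.comp continuous_subtype_val))).sub continuous_const
  obtain ⟨ha, hprod⟩ := prod_inv_one_sub_le hl0 hl1 hn0 ht ht1
  set a : Fin n → ℝ := fun i =>
    1 - t / 16 * (hT.eigenvalues hn i - (∑ j, hT.eigenvalues hn j) / n - t) with hadef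
  obtain ⟨c, hc0, hc1, hc⟩ := exists_lintegral_gaussian_basis (euclideanVolume E)
    (hT.eigenvectorBasis hn)
  have hnorm : ∀ x : E, ‖x‖ ^ 2 = ∑ i, ‖(hT.eigenvectorBasis hn).repr x i‖ ^ 2 := fun x => by
    rw [← (hT.eigenvectorBasis hn).repr.norm_map, EuclideanSpace.norm_sq_eq]
  have hq : ∀ x : E, ∑ i, a i * ‖(hT.eigenvectorBasis hn).repr x i‖ ^ 2 = ‖x‖ ^ 2 -
      t / 16 * ((inner ℂ x (T x)).re -
        (∑ j, hT.eigenvalues hn j) / n * ‖x‖ ^ 2 - t * ‖x‖ ^ 2) := fun x => by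
    rw [re_inner_apply_self_eq_sum hT hn, hnorm x, Finset.mul_sum, Finset.mul_sum,
      ← Finset.sum_sub_distrib, ← Finset.sum_sub_distrib, Finset.mul_sum, ← Finset.sum_sub_distrib]
    refine Finset.sum_congr rfl fun i _ => ?_
    simp only [hadef]
    ring
  have : FiniteDimensional ℝ E := FiniteDimensional.complexToReal E
  have key := toSphere_mul_lintegral_le (euclideanVolume E)
    (g := fun r => ENNReal.ofReal (Real.exp (-r ^ 2))) (by fun_prop) hS
    (f := fun x => ENNReal.ofReal
      (Real.exp (-∑ i, a i * ‖(hT.eigenvectorBasis hn).repr x i‖ ^ 2))) (by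
      intro x hx
      obtain ⟨φ, hφ, r, hr, rfl⟩ := exists_eq_smul_of_mem_sphereCone hx
      -- Both sides of the required inequality are homogeneous of degree two, so it reduces to the
      -- defining condition of `S` at the unit vector `φ`.
      refine ENNReal.ofReal_le_ofReal (Real.exp_le_exp.2 (neg_le_neg ?_))
      rw [hq]
      have h2 : ‖r • (φ : E)‖ ^ 2 = r ^ 2 := by simp [norm_smul]
      have h3 : (inner ℂ (r • (φ : E)) (T (r • (φ : E)))).re =
          r ^ 2 * (inner ℂ (φ : E) (T φ)).re := by
        rw [← Complex.coe_smul, map_smul, inner_smul_left, inner_smul_right]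
        simp [sq, mul_assoc]
      rw [h2, h3]
      have h4 : 0 ≤ r ^ 2 * ((inner ℂ (φ : E) (T φ)).re -
        (∑ j, hT.eigenvalues hn j) / n - t) := mul_nonneg (sq_nonneg r) (by linarith [hφ.out])
      nlinarith [mul_nonneg ht.le h4])
  -- All weights equal to `1` identify `c` as the Gaussian integral on the left of `key`.
  have hg : ∫⁻ x, ENNReal.ofReal (Real.exp (-‖x‖ ^ 2)) ∂(euclideanVolume E) = c := by
    have := hc 1 fun _ => one_pos
    simpa [← hnorm] using this
  rw [hc a ha, hg, mul_comm _ c] at key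
  exact ((ENNReal.mul_le_mul_iff_right hc0 hc1).1 key).trans (ENNReal.ofReal_le_ofReal hprod)

/-- Two-sided concentration of the expectation value of an operator `0 ≤ T ≤ 1` in a uniformly
distributed unit vector. -/
theorem uniformSphere_two_sided_tail [Nontrivial E] {T : E →ₗ[ℂ] E} (hT : T.IsSymmetric)
    (h0 : ∀ x, 0 ≤ (inner ℂ x (T x)).re) (h1 : ∀ x, (inner ℂ x (T x)).re ≤ ‖x‖ ^ 2)
    {t : ℝ} (ht : 0 < t) :
    (uniformSphere E).real {φ | t ≤ |(inner ℂ (φ : E) (T φ)).re -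
        (T.trace ℂ E).re / Module.finrank ℂ E|} ≤
      2 * Real.exp (-(Module.finrank ℂ E * t ^ 2 / 32)) := by
  have hn : (Module.finrank ℂ E : ℝ) ≠ 0 := by exact_mod_cast (Module.finrank_pos (R := ℂ)).ne'
  have hinner : ∀ x : E, (inner ℂ x ((LinearMap.id - T : E →ₗ[ℂ] E) x)).re =
      ‖x‖ ^ 2 - (inner ℂ x (T x)).re := fun x => by
    rw [LinearMap.sub_apply, inner_sub_right, LinearMap.id_apply, inner_self_eq_norm_sq_to_K,
      Complex.sub_re]
    norm_cast
  have hup := uniformSphere_upper_tail hT h0 h1 ht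
  -- The lower tail of `T` is the upper tail of `1 - T`, whose normalized trace is `1 - tr T / d`.
  have hlow := uniformSphere_upper_tail (T := LinearMap.id - T) (LinearMap.IsSymmetric.id.sub hT)
    (fun x => by rw [hinner]; linarith [h1 x]) (fun x => by rw [hinner]; linarith [h0 x]) ht
  have hle := fun S : Set (sphere (0 : E) 1) => fun h => ENNReal.toReal_mono
    ENNReal.ofReal_ne_top (show uniformSphere E S ≤
      ENNReal.ofReal (Real.exp (-(Module.finrank ℂ E * t ^ 2 / 32))) from h)
  simp_rw [ENNReal.toReal_ofReal (Real.exp_pos _).le] at hle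
  rw [two_mul]
  refine le_trans ?_ (add_le_add (hle _ hup) (hle _ hlow))
  refine le_trans (measureReal_mono ?_) (measureReal_union_le _ _)
  intro φ hφ
  rcases le_abs.1 (mem_ofPred_eq ▸ hφ) with h | h
  · exact Or.inl h
  · refine Or.inr ?_
    simp only [mem_ofPred_eq]
    rw [hinner, norm_eq_of_mem_sphere, map_sub, LinearMap.trace_id, Complex.sub_re, sub_div,
      Complex.natCast_re, div_self hn]
    linarith

end Concentration

/-! ### Reduction to projectors compressed to `R` -/

section Compression

variable {H : Type*} [NormedAddCommGroup H] [InnerProductSpace ℂ H] [FiniteDimensional ℂ H]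

/-- The compression of an operator to a subspace. -/
noncomputable def compression (R : Submodule ℂ H) (A : H →L[ℂ] H) : R →L[ℂ] R :=
  R.orthogonalProjectionOnto ∘L A ∘L R.subtypeL

theorem inner_compression_apply (R : Submodule ℂ H) (A : H →L[ℂ] H) (x y : R) :
    inner ℂ x (compression R A y) = inner ℂ (x : H) (A y) := by
  simp [compression]

theorem opTrace_mul_toOp (R : Submodule ℂ H) (A : H →L[ℂ] H) (ψ : PureState R) :
    opTrace (A * ψ.toOp) = LinearMap.trace ℂ R ((compression R A ∘L ψ.1 : R →L[ℂ] R) : R →ₗ[ℂ] R) :=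
  LinearMap.trace_comp_comm' (R.orthogonalProjectionOnto : H →ₗ[ℂ] R)
    ((A ∘L R.subtypeL ∘L ψ.1 : R →L[ℂ] H) : R →ₗ[ℂ] H)

theorem opTrace_mul_toOp_ofVector (R : Submodule ℂ H) (A : H →L[ℂ] H) (φ : sphere (0 : R) 1) :
    opTrace (A * (PureState.ofVector φ).toOp) = inner ℂ (φ : R) (compression R A φ) := by
  rw [opTrace_mul_toOp, ← InnerProductSpace.trace_rankOne]
  congr 1
  ext x
  simp [PureState.ofVector]

theorem mcExpectation_eq (R : Submodule ℂ H) (A : H →L[ℂ] H) :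
    mcExpectation R A = (Module.finrank ℂ R : ℂ)⁻¹ *
      LinearMap.trace ℂ R (compression R A : R →ₗ[ℂ] R) := by
  have : opTrace (R.starProjection * A) = LinearMap.trace ℂ R (compression R A : R →ₗ[ℂ] R) :=
    LinearMap.trace_comp_comm' ((R.orthogonalProjectionOnto ∘L A : H →L[ℂ] R) : H →ₗ[ℂ] R)
      (R.subtype)
  rw [← this, mcExpectation, microcanonicalState, smul_mul_assoc, opTrace,
    ContinuousLinearMap.toLinearMap_smul, map_smul, smul_eq_mul, opTrace]

theorem continuous_opTrace_mul_toOp (R : Submodule ℂ H) (A : H →L[ℂ] H) :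
    Continuous fun ψ : PureState R => opTrace (A * ψ.toOp) := by
  have h1 : Continuous fun B : R →L[ℂ] R =>
      LinearMap.trace ℂ R ((compression R A ∘L B : R →L[ℂ] R) : R →ₗ[ℂ] R) := by
    exact (LinearMap.continuous_of_finiteDimensional ((LinearMap.trace ℂ R).comp
      ((ContinuousLinearMap.coeLM ℂ).comp
        (ContinuousLinearMap.compL ℂ R R R (compression R A) :
          (R →L[ℂ] R) →ₗ[ℂ] (R →L[ℂ] R)))))
  simp_rw [opTrace_mul_toOp]
  exact h1.comp continuous_subtype_val

variable {m : ℕ}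

theorem abs_le_of_norm_sum_smul_starProjection_le {V : Fin m → Submodule ℂ H}
    (hne : ∀ r, V r ≠ ⊥) (horth : ∀ r s, r ≠ s → V r ⟂ V s) {α : Fin m → ℝ} {K : ℝ}
    (hK : ‖∑ r, (α r : ℂ) • (V r).starProjection‖ ≤ K) (r : Fin m) : |α r| ≤ K := by
  obtain ⟨v, hv, hv0⟩ := (V r).exists_mem_ne_zero_of_ne_bot (hne r)
  have happ : (∑ s, (α s : ℂ) • (V s).starProjection) v = (α r : ℂ) • v := by
    rw [sum_apply, Finset.sum_eq_single r]
    · rw [smul_apply, Submodule.starProjection_eq_self_iff.2 hv]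
    · intro s _ hs
      rw [smul_apply, (V s).starProjection_apply_eq_zero_iff.2, smul_zero]
      exact (horth r s hs.symm) hv
    · simp
  have h := (∑ s, (α s : ℂ) • (V s).starProjection).le_of_opNorm_le hK v
  rw [happ, norm_smul, Complex.norm_real, Real.norm_eq_abs] at h
  exact le_of_mul_le_mul_right h (norm_pos_iff.2 hv0)

theorem re_inner_starProjection_nonneg (W : Submodule ℂ H) (x : H) :
    0 ≤ (inner ℂ x (W.starProjection x)).re := by
  rw [← W.inner_starProjection_left_eq_right]
  exact W.re_inner_starProjection_nonneg x

theorem re_inner_starProjection_le (W : Submodule ℂ H) (x : H) :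
    (inner ℂ x (W.starProjection x)).re ≤ ‖x‖ ^ 2 := by
  refine (Complex.re_le_norm _).trans ((norm_inner_le_norm _ _).trans ?_)
  rw [sq]
  exact mul_le_mul_of_nonneg_left (W.norm_starProjection_apply_le x) (norm_nonneg x)

theorem isSymmetric_compression_starProjection (R W : Submodule ℂ H) :
    (compression R W.starProjection : R →ₗ[ℂ] R).IsSymmetric := by
  intro x y
  rw [ContinuousLinearMap.coe_coe, inner_compression_apply, ← inner_conj_symm, inner_compression_apply, inner_conj_symm,
    W.inner_starProjection_left_eq_right]

theorem isSymmetric_im_inner_self {E : Type*} [NormedAddCommGroup E] [InnerProductSpace ℂ E]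
    {T : E →ₗ[ℂ] E} (hT : T.IsSymmetric) (x : E) : (inner ℂ x (T x)).im = 0 := by
  rw [← Complex.conj_eq_iff_im, inner_conj_symm, hT]

theorem im_trace_eq_zero_of_isSymmetric {E : Type*} [NormedAddCommGroup E]
    [InnerProductSpace ℂ E] [FiniteDimensional ℂ E] {T : E →ₗ[ℂ] E} (hT : T.IsSymmetric) :
    (T.trace ℂ E).im = 0 := by
  rw [hT.trace_eq_sum_eigenvalues rfl]
  simp

theorem opTrace_sum_smul_mul_sub_mcExpectation {R : Submodule ℂ H} (V : Fin m → Submodule ℂ H)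
    (α : Fin m → ℝ) (ψ : PureState R) :
    opTrace ((∑ r, (α r : ℂ) • (V r).starProjection) * ψ.toOp) -
        mcExpectation R (∑ r, (α r : ℂ) • (V r).starProjection) =
      ∑ r, (α r : ℂ) * (opTrace ((V r).starProjection * ψ.toOp) -
        mcExpectation R (V r).starProjection) := by
  simp only [mcExpectation, opTrace, Finset.sum_mul, Finset.mul_sum, smul_mul_assoc,
    mul_smul_comm, ContinuousLinearMap.toLinearMap_sum, ContinuousLinearMap.toLinearMap_smul,
    map_sum, map_smul, smul_eq_mul, mul_sub, Finset.sum_sub_distrib]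

theorem exists_projector_deviation {R : Submodule ℂ H} {V : Fin m → Submodule ℂ H}
    (hne : ∀ r, V r ≠ ⊥) (horth : ∀ r s, r ≠ s → V r ⟂ V s) {ε K : ℝ} (hK : 0 < K) (hε : 0 < ε)
    {ψ : PureState R} {A : H →L[ℂ] H} (hA : A ∈ accessibleObservables V) (hAK : ‖A‖ ≤ K)
    (h : ε ≤ ‖opTrace (A * ψ.toOp) - mcExpectation R A‖) :
    ∃ r, ε / (m * K) ≤ ‖opTrace ((V r).starProjection * ψ.toOp) -
      mcExpectation R (V r).starProjection‖ := by
  obtain ⟨α, rfl⟩ := hA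
  by_contra! hlt
  rw [opTrace_sum_smul_mul_sub_mcExpectation] at h
  -- For `m = 0` the sum is empty and `h` reads `ε ≤ 0`.
  rcases Nat.eq_zero_or_pos m with rfl | hm
  · simp at h
    linarith
  have hm' : (0 : ℝ) < m := by exact_mod_cast hm
  have : Nonempty (Fin m) := ⟨⟨0, hm⟩⟩
  refine absurd h (not_le.2 ?_)
  calc _ ≤ ∑ r, ‖(α r : ℂ) * (opTrace ((V r).starProjection * ψ.toOp) -
        mcExpectation R (V r).starProjection)‖ := norm_sum_le _ _
    _ ≤ ∑ r, K * ‖opTrace ((V r).starProjection * ψ.toOp) -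
        mcExpectation R (V r).starProjection‖ := by
      refine Finset.sum_le_sum fun r _ => ?_
      rw [norm_mul, Complex.norm_real, Real.norm_eq_abs]
      exact mul_le_mul_of_nonneg_right
        (abs_le_of_norm_sum_smul_starProjection_le hne horth hAK r) (norm_nonneg _)
    _ < ∑ _r : Fin m, K * (ε / (m * K)) :=
      Finset.sum_lt_sum_of_nonempty Finset.univ_nonempty fun r _ =>
        mul_lt_mul_of_pos_left (hlt r) hK
    _ = ε := by
      rw [Finset.sum_const, Finset.card_univ, Fintype.card_fin, nsmul_eq_mul]
      field_simp

variable [MeasurableSpace H] [BorelSpace H]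

/-- Typicality of the expectation value of a projector in a random pure state. -/
theorem haarPure_projector_tail {R : Submodule ℂ H} (hR : R ≠ ⊥) (W : Submodule ℂ H) {t : ℝ}
    (ht : 0 < t) :
    (haarPure R).real {ψ | t ≤ ‖opTrace (W.starProjection * ψ.toOp) -
        mcExpectation R W.starProjection‖} ≤
      2 * Real.exp (-(Module.finrank ℂ R * t ^ 2 / 32)) := by
  have : Nontrivial R := Submodule.nontrivial_iff_ne_bot.2 hR
  have hsymm := isSymmetric_compression_starProjection R W
  have hmeas : MeasurableSet {ψ : PureState R | t ≤ ‖opTrace (W.starProjection * ψ.toOp) -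
      mcExpectation R W.starProjection‖} :=
    (isClosed_le continuous_const
      ((continuous_opTrace_mul_toOp R _).sub continuous_const).norm).measurableSet
  rw [haarPure, measureReal_def,
    Measure.map_apply PureState.continuous_ofVector.measurable hmeas, ← measureReal_def]
  refine le_trans (le_of_eq ?_) (uniformSphere_two_sided_tail hsymm
    (fun x => by
      rw [ContinuousLinearMap.coe_coe, inner_compression_apply]
      exact re_inner_starProjection_nonneg W x)
    (fun x => by
      rw [ContinuousLinearMap.coe_coe, inner_compression_apply]
      exact re_inner_starProjection_le W x) ht)
  congr 1
  ext φ
  simp only [mem_preimage, mem_ofPred_eq]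
  rw [opTrace_mul_toOp_ofVector, mcExpectation_eq]
  -- Symmetry of the compression makes both the expectation value and the trace real, so the complex
  -- norm is the absolute value in the tail bound.
  have h1 := Complex.ext (z := inner ℂ (φ : R) (compression R W.starProjection φ))
    (w := ((inner ℂ (φ : R) (compression R W.starProjection φ)).re : ℂ)) (by simp)
    (by simpa using isSymmetric_im_inner_self hsymm φ)
  have h2 := Complex.ext
    (z := LinearMap.trace ℂ R (compression R W.starProjection : R →ₗ[ℂ] R))
    (w := ((LinearMap.trace ℂ R (compression R W.starProjection : R →ₗ[ℂ] R)).re : ℂ)) (by simp)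
    (by simpa using im_trace_eq_zero_of_isSymmetric hsymm)
  rw [h1, h2, ← Complex.ofReal_natCast, ← Complex.ofReal_inv, ← Complex.ofReal_mul,
    ← Complex.ofReal_sub, Complex.norm_real, Real.norm_eq_abs, inv_mul_eq_div, ContinuousLinearMap.coe_coe,
    Complex.ofReal_re]

end Compression

end MacroTypicality

/-! ### Union bound over the macroscopic subspaces -/

theorem mainTheorem3 {H : Type*} [NormedAddCommGroup H] [InnerProductSpace ℂ H]
    [FiniteDimensional ℂ H] [MeasurableSpace H] [BorelSpace H]
    (M : Set (H →L[ℂ] H)) (hM : MacroTypicality.IsMacroObservableSet M)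
    (m : ℕ) (V : Fin m → Submodule ℂ H) (hV : MacroTypicality.IsMacroPartition M V)
    (R : Submodule ℂ H) (hR : R ≠ ⊥) (K : ℝ) (hK : 0 < K) (ε : ℝ) (hε : 0 < ε) :
    (MacroTypicality.haarPure R).real
        {ψ | ∃ A ∈ MacroTypicality.accessibleObservables V, ‖A‖ ≤ K ∧
          ε ≤ ‖MacroTypicality.opTrace (A * ψ.toOp) - MacroTypicality.mcExpectation R A‖}
      ≤ 2 * m * Real.exp (-((36 * Real.pi ^ 3)⁻¹ * Module.finrank ℂ R * ε ^ 2 /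
          (m ^ 2 * K ^ 2))) := by
  have : Nontrivial R := Submodule.nontrivial_iff_ne_bot.2 hR
  have hsub : {ψ : MacroTypicality.PureState R |
      ∃ A ∈ MacroTypicality.accessibleObservables V, ‖A‖ ≤ K ∧
        ε ≤ ‖MacroTypicality.opTrace (A * ψ.toOp) - MacroTypicality.mcExpectation R A‖} ⊆
      ⋃ r, {ψ | ε / (m * K) ≤ ‖MacroTypicality.opTrace ((V r).starProjection * ψ.toOp) -
        MacroTypicality.mcExpectation R (V r).starProjection‖} := by
    rintro ψ ⟨A, hA, hAK, h⟩
    exact Set.mem_iUnion.2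
      (MacroTypicality.exists_projector_deviation hV.ne_bot hV.orthogonal hK hε hA hAK h)
  refine (measureReal_mono hsub).trans ((measureReal_iUnion_fintype_le _).trans ?_)
  have hbound : ∀ r, (MacroTypicality.haarPure R).real
      {ψ | ε / (m * K) ≤ ‖MacroTypicality.opTrace ((V r).starProjection * ψ.toOp) -
        MacroTypicality.mcExpectation R (V r).starProjection‖} ≤
      2 * Real.exp (-((36 * Real.pi ^ 3)⁻¹ * Module.finrank ℂ R * ε ^ 2 /
          (m ^ 2 * K ^ 2))) := by
    intro r
    -- The index `r : Fin m` itself forces `m` to be positive.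
    have hm : (0 : ℝ) < m := by exact_mod_cast r.pos
    refine (MacroTypicality.haarPure_projector_tail hR (V r) (by positivity)).trans ?_
    refine mul_le_mul_of_nonneg_left (Real.exp_le_exp.2 (neg_le_neg ?_)) zero_le_two
    have hpi : (36 * Real.pi ^ 3)⁻¹ ≤ (32 : ℝ)⁻¹ := by
      refine inv_anti₀ (by norm_num) ?_
      have : (1 : ℝ) ≤ Real.pi ^ 3 := one_le_pow₀ (by linarith [Real.pi_gt_three])
      linarith
    calc (36 * Real.pi ^ 3)⁻¹ * Module.finrank ℂ R * ε ^ 2 / (m ^ 2 * K ^ 2)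
        ≤ 32⁻¹ * Module.finrank ℂ R * ε ^ 2 / (m ^ 2 * K ^ 2) := by gcongr
      _ = Module.finrank ℂ R * (ε / (m * K)) ^ 2 / 32 := by
        rw [div_pow, mul_pow]; ring
  refine (Finset.sum_le_sum fun r _ => hbound r).trans (le_of_eq ?_)
  rw [Finset.sum_const, Finset.card_univ, Fintype.card_fin, nsmul_eq_mul]
  ring
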